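/- Let $a_1,a_2,a_3,a_4$ be real polynomials with $\deg a_k\le k$ for each $k$ and $a_4\neq 0$, and let $L=\sum_{k=1}^{4}a_k(x)\,D^k$, where $D=d/dx$. Suppose that $L$ is self-adjoint in the following sense: there are a nondegenerate interval $I\subseteq\mathbb{R}$, bounded or unbounded, and a function $p$ that is piecewise smooth on $I$ (that is, $C^\infty$ in the interior of $I$ away from a set having only finitely many points in each compact interval), with $\int_I |p\,u|\,dx<\infty$ for every polynomial $u$, such that $\langle u,v\rangle=\int_I p\,u\,v\,dx$ is an inner product on the space $\mathcal{E}$ of (restrictions to $I$ of) $C^\infty$ functions on $\mathbb{R}$ that are, together with each of their derivatives, bounded by a polynomial, and $\langle Lu,v\rangle=\langle u,Lv\rangle$ for all $u,v\in\mathcal{E}$. (If $I$ is bounded, $\mathcal{E}$ consists of the restrictions to $I$ of all $C^\infty$ functions on $\mathbb{R}$.) If $a_4$ has more than one real root, then $a_4$ has exactly two distinct real roots, each of them is a root of $a_4$ of multiplicity exactly $2$, and each of them is a root of $a_3$ of multiplicity exactly $1$. -/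

import Mathlib

open scoped ContDiff

noncomputable section

namespace PolyDiffOp

/-- The differential operator `L = ∑_{k=1}^{n} a_k D^k` with polynomial coefficients,
applied to a function `y : ℝ → ℝ`. -/
def apply (n : ℕ) (a : ℕ → Polynomial ℝ) (y : ℝ → ℝ) (x : ℝ) : ℝ :=
  ∑ k ∈ Finset.Icc 1 n, (a k).eval x * iteratedDeriv k y x

/-- `L = ∑_{k=1}^{n} a_k D^k` has order exactly `n`, and `deg a_k ≤ k` for every `k`, so that
`L` maps polynomials of degree at most `N` to such polynomials, for every `N`. -/
structure HasOrder (n : ℕ) (a : ℕ → Polynomial ℝ) : Prop where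
  leading_ne_zero : a n ≠ 0
  natDegree_le : ∀ k ∈ Finset.Icc 1 n, (a k).natDegree ≤ k

/-- The bilinear form `⟨u, v⟩ = ∫_I p u v dx`. -/
def form (I : Set ℝ) (p u v : ℝ → ℝ) : ℝ :=
  ∫ x in I, p x * u x * v x

/-- `p` is piecewise smooth on `I`: it is `C^∞` in the interior of `I` away from a set of
points of which every compact interval contains only finitely many. Nothing is required at
these points or at the endpoints of `I` (classical weights may blow up there). -/
def PiecewiseSmooth (I : Set ℝ) (p : ℝ → ℝ) : Prop :=
  ∃ S : Set ℝ, (∀ c d : ℝ, (S ∩ Set.Icc c d).Finite) ∧ ContDiffOn ℝ ∞ p (interior I \ S)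

/-- `p` is an admissible weight on `I`: it is piecewise smooth, `p u` is integrable over `I` for
every polynomial `u`, and `⟨u, v⟩ = ∫_I p u v dx` is positive definite on the smooth functions.

The smooth functions used are those of `Function.HasTemperateGrowth`, that is, the `C^∞`
functions which are bounded by a polynomial together with each of their derivatives: for these
the integrals converge. On a bounded interval they have the same restrictions as all `C^∞`
functions on `ℝ`; polynomials and compactly supported `C^∞` functions are always among them. -/
structure IsAdmissibleWeight (I : Set ℝ) (p : ℝ → ℝ) : Prop where
  piecewiseSmooth : PiecewiseSmooth I p
  integrable : ∀ u : Polynomial ℝ, MeasureTheory.IntegrableOn (fun x => p x * u.eval x) I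
  posDef : ∀ u : ℝ → ℝ, u.HasTemperateGrowth → (∃ x ∈ I, u x ≠ 0) → 0 < form I p u u

/-- `L = ∑_{k=1}^{n} a_k D^k` is a self-adjoint operator of order `n`: for some nondegenerate
interval `I` (bounded or not) and some admissible weight `p` on `I`, one has
`⟨L u, v⟩ = ⟨u, L v⟩` for all smooth `u` and `v`. -/
def IsSelfAdjointOfOrder (n : ℕ) (a : ℕ → Polynomial ℝ) : Prop :=
  HasOrder n a ∧
    ∃ (I : Set ℝ) (p : ℝ → ℝ), I.OrdConnected ∧ (interior I).Nonempty ∧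
      IsAdmissibleWeight I p ∧
      ∀ u v : ℝ → ℝ, u.HasTemperateGrowth → v.HasTemperateGrowth →
        form I p (apply n a u) v = form I p u (apply n a v)

end PolyDiffOp

end

/-!
Extend the weight by zero to `P` on the line and test the symmetry of `L` on `x ^ i * u` against
`x ^ j` with `u` compactly supported. For the commutators of `L` with `x` this yields, in the sense
of distributions and on the whole line, `(2 a₄ P)' = a₃ P` and `(a₃ P)'' - (2 a₂ P)' + 2 a₁ P = 0`.
So `2 a₄ P` and `a₃ P` have continuous representatives, and at a finite endpoint `r` of `I` the
Cauchy data of the system vanish, as `P = 0` outside `I`. Were `a₃ r ≠ 0`, or were `a₃ / a₄`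
regular at `r`, then uniqueness for linear ODEs would give `P = 0` near `r`; hence
`1 ≤ ord_r a₃ < ord_r a₄`.

Eliminating `P` leaves a polynomial identity among the `aₖ`, which for `2 ≤ deg a₄` forces
`deg a₃ < deg a₄` or `deg a₃ = deg a₄ = 2`. In the first case an infinite end of `I` is impossible:
`y = 2 a₄ P` satisfies `y' = (a₃ / (2 a₄)) y`, so `t ^ N * y` grows in absolute value for large `N`
and some moment of `P` diverges. Thus `I` has two finite endpoints, each a root of `a₄` of
multiplicity at least `2`, which exhausts the degree `4`. In the second case the same argument
leaves at least one finite endpoint, a double root of the quadratic `a₄`, against the assumption of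
two distinct roots.
-/

namespace PolyDiffOp

open MeasureTheory Polynomial Set Filter Topology

section WeakDerivatives

/-- Test functions on the line: smooth functions of compact support. -/
structure IsTestFunction (u : ℝ → ℝ) : Prop where
  contDiff : ContDiff ℝ ∞ u
  hasCompactSupport : HasCompactSupport u

variable {f g h u φ F : ℝ → ℝ}

theorem IsTestFunction.deriv (hu : IsTestFunction u) : IsTestFunction (deriv u) :=
  ⟨(contDiff_infty_iff_deriv.1 hu.contDiff).2, hu.hasCompactSupport.deriv⟩

theorem IsTestFunction.hasDerivAt (hu : IsTestFunction u) (x : ℝ) :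
    HasDerivAt u (_root_.deriv u x) x :=
  (hu.contDiff.differentiable (by simp)).differentiableAt.hasDerivAt

theorem IsTestFunction.smooth_mul (hf : ContDiff ℝ ∞ f) (hu : IsTestFunction u) :
    IsTestFunction (fun x => f x * u x) :=
  ⟨hf.mul hu.contDiff, hu.hasCompactSupport.mul_left⟩

theorem IsTestFunction.const_mul (c : ℝ) (hu : IsTestFunction u) :
    IsTestFunction (fun x => c * u x) :=
  hu.smooth_mul contDiff_const

theorem IsTestFunction.sub (hu : IsTestFunction u) (hφ : IsTestFunction φ) :
    IsTestFunction (fun x => u x - φ x) :=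
  ⟨hu.contDiff.sub hφ.contDiff, hu.hasCompactSupport.sub hφ.hasCompactSupport⟩

theorem IsTestFunction.integrable_mul (hu : IsTestFunction u) (hf : LocallyIntegrable f) :
    Integrable fun x => f x * u x := by
  simpa only [smul_eq_mul, mul_comm] using
    hf.integrable_smul_left_of_hasCompactSupport hu.contDiff.continuous hu.hasCompactSupport

theorem IsTestFunction.integrable (hu : IsTestFunction u) : Integrable u :=
  hu.contDiff.continuous.integrable_of_hasCompactSupport hu.hasCompactSupport

theorem IsTestFunction.exists_tsupport_subset_Ioo (hu : IsTestFunction u) :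
    ∃ R, tsupport u ⊆ Ioo (-R) R := by
  simpa only [Real.ball_eq_Ioo, zero_sub, zero_add] using
    hu.hasCompactSupport.isCompact.isBounded.subset_ball 0

theorem exists_isTestFunction_integral_eq_one : ∃ ψ, IsTestFunction ψ ∧ ∫ x, ψ x = 1 := by
  let b : ContDiffBump (0 : ℝ) := ⟨1, 2, one_pos, one_lt_two⟩
  exact ⟨b.normed volume, ⟨b.contDiff_normed, b.hasCompactSupport_normed⟩, b.integral_normed⟩

theorem IsTestFunction.exists_deriv_eq (hφ : IsTestFunction φ) (h0 : ∫ x, φ x = 0) :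
    ∃ u, IsTestFunction u ∧ _root_.deriv u = φ := by
  obtain ⟨R, hR⟩ := hφ.exists_tsupport_subset_Ioo
  have hsupp := (subset_tsupport φ).trans hR
  have hcont := hφ.contDiff.continuous
  have hderiv : _root_.deriv (fun x => ∫ t in -R..x, φ t) = φ :=
    funext fun x => hcont.deriv_integral φ (-R) x
  refine ⟨fun x => ∫ t in -R..x, φ t, ⟨contDiff_infty_iff_deriv.2 ⟨fun x => ?_, ?_⟩, ?_⟩, hderiv⟩
  · exact (hcont.integral_hasStrictDerivAt (-R) x).hasDerivAt.differentiableAt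
  · rw [hderiv]
    exact hφ.contDiff
  · refine HasCompactSupport.intro (isCompact_Icc (a := -R) (b := R)) fun x hx => ?_
    rw [mem_Icc, not_and_or, not_le, not_le] at hx
    rcases hx with hx | hx
    · refine intervalIntegral.integral_zero_ae (.of_forall fun t ht => ?_)
      rw [uIoc_of_ge hx.le] at ht
      exact Function.notMem_support.1 fun h => (hsupp h).1.not_ge ht.2
    · rw [intervalIntegral.integral_eq_integral_of_support_subset, h0]
      exact fun t ht => ⟨(hsupp ht).1, (hsupp ht).2.le.trans hx.le⟩

theorem exists_forall_eq_mul_integral {T : (ℝ → ℝ) → ℝ}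
    (hT : ∀ φ ψ, IsTestFunction φ → IsTestFunction ψ → ∀ m : ℝ,
      T (fun x => φ x - m * ψ x) = T φ - m * T ψ)
    (hderiv : ∀ u, IsTestFunction u → T (deriv u) = 0) :
    ∃ c, ∀ φ, IsTestFunction φ → T φ = c * ∫ x, φ x := by
  obtain ⟨ψ, hψ, hψ1⟩ := exists_isTestFunction_integral_eq_one
  refine ⟨T ψ, fun φ hφ => ?_⟩
  obtain ⟨u, hu, hu'⟩ := (hφ.sub (hψ.const_mul (∫ x, φ x))).exists_deriv_eq (by
    rw [integral_sub hφ.integrable (hψ.integrable.const_mul _), integral_const_mul, hψ1]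
    ring)
  have := hderiv u hu
  rw [hu', hT φ ψ hφ hψ] at this
  linarith

/-- `F` is an indefinite Lebesgue integral of `f`; equivalently, `F` is locally absolutely
continuous with derivative `f` almost everywhere. -/
structure IsPrimitive (F f : ℝ → ℝ) : Prop where
  locallyIntegrable : LocallyIntegrable f
  integral_eq : ∀ x y, ∫ t in x..y, f t = F y - F x

theorem intervalIntegrable_of_locallyIntegrable (hf : LocallyIntegrable f)
    (x y : ℝ) : IntervalIntegrable f volume x y :=
  (hf.integrableOn_isCompact isCompact_uIcc).intervalIntegrable

theorem exists_isPrimitive (hf : LocallyIntegrable f) : ∃ F, IsPrimitive F f :=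
  ⟨fun x => ∫ t in 0..x, f t, hf, fun x y => by
    rw [intervalIntegral.integral_interval_sub_left] <;>
      exact intervalIntegrable_of_locallyIntegrable hf _ _⟩

theorem IsPrimitive.eq_add_integral (hF : IsPrimitive F f) (x : ℝ) :
    F = fun y => F x + ∫ t in x..y, f t :=
  funext fun y => by rw [hF.integral_eq]; ring

theorem IsPrimitive.continuous (hF : IsPrimitive F f) : Continuous F := by
  rw [hF.eq_add_integral 0]
  exact continuous_const.add <| intervalIntegral.continuous_primitive
    (intervalIntegrable_of_locallyIntegrable hF.locallyIntegrable) 0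

theorem IsPrimitive.add_const (hF : IsPrimitive F f) (c : ℝ) :
    IsPrimitive (fun x => F x + c) f :=
  ⟨hF.locallyIntegrable, fun x y => by rw [hF.integral_eq]; ring⟩

theorem IsPrimitive.hasDerivAt_of_ae_eq (hF : IsPrimitive F f) {U : Set ℝ} (hU : IsOpen U)
    (hfg : f =ᵐ[volume.restrict U] g) (hg : ContinuousOn g U) {x : ℝ} (hx : x ∈ U) :
    HasDerivAt F (g x) x := by
  obtain ⟨ε, hε, hball⟩ := Metric.isOpen_iff.1 hU x hx
  have hsub : ∀ y ∈ Metric.ball x ε, uIcc x y ⊆ U := fun y hy =>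
    ((convex_ball x ε).ordConnected.uIcc_subset (Metric.mem_ball_self hε) hy).trans hball
  have hF' : F =ᶠ[𝓝 x] fun y => F x + ∫ t in x..y, g t := by
    filter_upwards [Metric.ball_mem_nhds x hε] with y hy
    rw [intervalIntegral.integral_congr_ae_restrict (g := f), hF.integral_eq]
    · ring
    · exact ae_restrict_of_ae_restrict_of_subset (uIoc_subset_uIcc.trans (hsub y hy)) hfg.symm
  refine HasDerivAt.congr_of_eventuallyEq (.const_add _ ?_) hF'
  exact intervalIntegral.integral_hasDerivAt_right IntervalIntegrable.refl
    (hg.stronglyMeasurableAtFilter hU x hx) (hg.continuousAt (hU.mem_nhds hx))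

theorem IsPrimitive.hasDerivAt_of_continuous (hF : IsPrimitive F f) (hfg : f =ᵐ[volume] g)
    (hg : Continuous g) (x : ℝ) : HasDerivAt F (g x) x :=
  hF.hasDerivAt_of_ae_eq isOpen_univ (ae_restrict_of_ae hfg) hg.continuousOn (mem_univ x)

theorem IsPrimitive.integral_mul_deriv (hF : IsPrimitive F f) (hu : IsTestFunction u) :
    ∫ x, F x * deriv u x = -∫ x, f x * u x := by
  obtain ⟨R, hsupp⟩ := hu.exists_tsupport_subset_Ioo
  have hu0 : ∀ x, x ∉ Ioo (-R) R → u x = 0 := fun x hx =>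
    image_eq_zero_of_notMem_tsupport fun h => hx (hsupp h)
  have hint : IntervalIntegrable f volume (-R) R :=
    intervalIntegrable_of_locallyIntegrable hF.locallyIntegrable _ _
  have hFac : AbsolutelyContinuousOnInterval F (-R) R := by
    rw [hF.eq_add_integral (-R)]
    exact contDiffOn_const.absolutelyContinuousOnInterval.fun_add
      (hint.absolutelyContinuousOnInterval_intervalIntegral left_mem_uIcc)
  have huac : AbsolutelyContinuousOnInterval u (-R) R :=
    (hu.contDiff.of_le (by simp)).contDiffOn.absolutelyContinuousOnInterval
  have hFderiv : ∀ᵐ x, x ∈ uIoc (-R) R → deriv F x * u x = f x * u x := by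
    filter_upwards [hint.ae_hasDerivAt_integral] with x hx hxR
    have := (hx (uIoc_subset_uIcc hxR) (-R) left_mem_uIcc).const_add (F (-R))
    rw [← hF.eq_add_integral (-R)] at this
    rw [this.deriv]
  rw [← intervalIntegral.integral_eq_integral_of_support_subset (a := -R) (b := R),
    hFac.integral_mul_deriv_eq_deriv_mul huac, intervalIntegral.integral_congr_ae hFderiv,
    intervalIntegral.integral_eq_integral_of_support_subset, hu0 R (by simp), hu0 (-R) (by simp)]
  · ring
  · exact (Function.support_mul_subset_right _ _).trans
      ((subset_tsupport u).trans (hsupp.trans Ioo_subset_Ioc_self))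
  · exact (Function.support_mul_subset_right _ _).trans
      (support_deriv_subset.trans (hsupp.trans Ioo_subset_Ioc_self))

theorem exists_ae_eq_const_of_integral_mul_deriv_eq_zero (hf : LocallyIntegrable f)
    (h0 : ∀ u, IsTestFunction u → ∫ x, f x * deriv u x = 0) :
    ∃ c : ℝ, f =ᵐ[volume] fun _ => c := by
  obtain ⟨c, hc⟩ := exists_forall_eq_mul_integral (T := fun φ => ∫ x, f x * φ x)
    (fun φ ψ hφ hψ m => by
      rw [← integral_const_mul, ← integral_sub (hφ.integrable_mul hf)
        ((hψ.integrable_mul hf).const_mul m)]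
      exact integral_congr_ae (.of_forall fun x => by ring)) h0
  refine ⟨c, ae_eq_of_integral_contDiff_smul_eq hf (locallyIntegrable_const c) fun φ hφ hφc => ?_⟩
  simpa only [smul_eq_mul, mul_comm, integral_const_mul] using hc φ ⟨hφ, hφc⟩

theorem exists_isPrimitive_of_weak_first_order (hf : LocallyIntegrable f)
    (hg : LocallyIntegrable g)
    (h0 : ∀ u, IsTestFunction u → ∫ x, (f x * deriv u x + g x * u x) = 0) :
    ∃ F, IsPrimitive F g ∧ f =ᵐ[volume] F := by
  obtain ⟨G, hG⟩ := exists_isPrimitive hg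
  have hGloc := hG.continuous.locallyIntegrable (μ := volume)
  obtain ⟨c, hc⟩ := exists_ae_eq_const_of_integral_mul_deriv_eq_zero (hf.sub hGloc) fun u hu => by
    have hweak := h0 u hu
    rw [integral_add (hu.deriv.integrable_mul hf) (hu.integrable_mul hg)] at hweak
    simp only [Pi.sub_apply, sub_mul]
    rw [integral_sub (hu.deriv.integrable_mul hf) (hu.deriv.integrable_mul hGloc),
      hG.integral_mul_deriv hu]
    linarith
  refine ⟨_, hG.add_const c, ?_⟩
  filter_upwards [hc] with x hx
  rw [← hx, Pi.sub_apply, add_sub_cancel]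

theorem exists_const_of_weak_deriv_eq_zero (hf : LocallyIntegrable f) (hg : LocallyIntegrable g)
    (h0 : ∀ u, IsTestFunction u → ∫ x, (f x * deriv (deriv u) x + g x * deriv u x) = 0) :
    ∃ c, ∀ φ, IsTestFunction φ → ∫ x, (f x * deriv φ x + (g x - c) * φ x) = 0 := by
  have hint : ∀ φ, IsTestFunction φ → Integrable fun x => f x * deriv φ x + g x * φ x :=
    fun φ hφ => (hφ.deriv.integrable_mul hf).add (hφ.integrable_mul hg)
  obtain ⟨c, hc⟩ := exists_forall_eq_mul_integral
    (T := fun φ => ∫ x, (f x * deriv φ x + g x * φ x))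
    (fun φ ψ hφ hψ m => by
      rw [← integral_const_mul, ← integral_sub (hint φ hφ) ((hint ψ hψ).const_mul m)]
      refine integral_congr_ae (.of_forall fun x => ?_)
      beta_reduce
      rw [((hφ.hasDerivAt x).fun_sub ((hψ.hasDerivAt x).const_mul m)).deriv]
      ring) h0
  refine ⟨c, fun φ hφ => ?_⟩
  rw [← sub_eq_zero.2 (hc φ hφ), ← integral_const_mul,
    ← integral_sub (hint φ hφ) (hφ.integrable.const_mul c)]
  exact integral_congr_ae (.of_forall fun x => by ring)

theorem exists_isPrimitive_of_weak_second_order (hf : LocallyIntegrable f)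
    (hg : LocallyIntegrable g) (hh : LocallyIntegrable h)
    (h0 : ∀ u, IsTestFunction u →
      ∫ x, (f x * deriv (deriv u) x + g x * deriv u x + h x * u x) = 0) :
    ∃ G F, IsPrimitive G h ∧ IsPrimitive F (fun x => g x - G x) ∧ f =ᵐ[volume] F := by
  obtain ⟨G, hG⟩ := exists_isPrimitive hh
  have hGloc := hG.continuous.locallyIntegrable (μ := volume)
  obtain ⟨c, hc⟩ := exists_const_of_weak_deriv_eq_zero hf (hg.sub hGloc) fun u hu => by
    have hweak := h0 u hu
    have hfg : Integrable fun x => f x * deriv (deriv u) x + g x * deriv u x :=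
      (hu.deriv.deriv.integrable_mul hf).add (hu.deriv.integrable_mul hg)
    rw [integral_add hfg (hu.integrable_mul hh)] at hweak
    simp only [Pi.sub_apply, sub_mul, ← add_sub_assoc]
    rw [integral_sub hfg (hu.deriv.integrable_mul hGloc), hG.integral_mul_deriv hu]
    linarith
  obtain ⟨F, hF, hfF⟩ := exists_isPrimitive_of_weak_first_order hf
    ((hg.sub hGloc).sub (locallyIntegrable_const c)) hc
  refine ⟨_, F, hG.add_const c, ?_, hfF⟩
  simp only [← sub_sub]
  exact hF

end WeakDerivatives

section WeakEquations

variable {n : ℕ} {a : ℕ → ℝ[X]} {P u : ℝ → ℝ}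

theorem contDiff_eval (q : ℝ[X]) : ContDiff ℝ ∞ fun x => q.eval x := by
  simp only [← coe_aeval_eq_eval]
  exact q.contDiff_aeval ∞

theorem contDiff_apply (n : ℕ) (a : ℕ → ℝ[X]) (hu : ContDiff ℝ ∞ u) :
    ContDiff ℝ ∞ (apply n a u) := by
  refine ContDiff.sum fun k _ => (contDiff_eval (a k)).mul ?_
  clear * - hu
  induction k with
  | zero => rwa [iteratedDeriv_zero]
  | succ k ih => rw [iteratedDeriv_succ]; exact (contDiff_infty_iff_deriv.1 ih).2

theorem IsTestFunction.apply (n : ℕ) (a : ℕ → ℝ[X]) (hu : IsTestFunction u) :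
    IsTestFunction (PolyDiffOp.apply n a u) := by
  have hiter : ∀ k, HasCompactSupport (iteratedDeriv k u) := fun k => by
    induction k with
    | zero => simpa only [iteratedDeriv_zero] using hu.hasCompactSupport
    | succ k ih => rw [iteratedDeriv_succ]; exact ih.deriv
  have hsum : PolyDiffOp.apply n a u =
      ∑ k ∈ Finset.Icc 1 n, fun x => (a k).eval x * iteratedDeriv k u x :=
    funext fun x => by rw [PolyDiffOp.apply, Finset.sum_apply]
  refine ⟨contDiff_apply n a hu.contDiff, ?_⟩
  rw [hsum]
  exact Finset.sum_induction _ HasCompactSupport (fun _ _ => .add) .zero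
    fun k _ => (hiter k).mul_left

/-- The integrand `x ^ j * L (x ^ i * u) - x ^ i * u * L (x ^ j)`, without the weight, of
`⟨L (x ^ i * u), x ^ j⟩ - ⟨x ^ i * u, L (x ^ j)⟩`. -/
noncomputable def symmDefect (n : ℕ) (a : ℕ → ℝ[X]) (u : ℝ → ℝ) (i j : ℕ) (x : ℝ) : ℝ :=
  x ^ j * apply n a (fun t => t ^ i * u t) x - x ^ i * u x * apply n a (fun t => t ^ j) x

theorem apply_pow_mul (n : ℕ) (a : ℕ → ℝ[X]) (hu : ContDiff ℝ ∞ u) (i : ℕ) (x : ℝ) :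
    apply n a (fun t => t ^ i * u t) x = ∑ k ∈ Finset.Icc 1 n, (a k).eval x *
      ∑ l ∈ Finset.range (k + 1), k.choose l * (i.descFactorial l * x ^ (i - l)) *
        iteratedDeriv (k - l) u x := by
  refine Finset.sum_congr rfl fun k _ => ?_
  rw [iteratedDeriv_fun_mul (f := fun t : ℝ => t ^ i) (contDiff_id.pow i).contDiffAt
    (hu.of_le (by exact_mod_cast le_top)).contDiffAt]
  simp only [iteratedDeriv_pow]

/-- The functions whose integral against `P` exists and vanishes. -/
def annihilator (P : ℝ → ℝ) : Submodule ℝ (ℝ → ℝ) where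
  carrier := {φ | Integrable (fun x => P x * φ x) ∧ ∫ x, P x * φ x = 0}
  zero_mem' := by simp
  add_mem' := fun {φ ψ} hφ hψ => by
    have e : (fun x => P x * (φ + ψ) x) = fun x => P x * φ x + P x * ψ x :=
      funext fun x => mul_add _ _ _
    rw [mem_ofPred_eq, e, integral_add hφ.1 hψ.1, hφ.2, hψ.2, add_zero]
    exact ⟨hφ.1.add hψ.1, rfl⟩
  smul_mem' := fun c φ hφ => by
    have e : (fun x => P x * (c • φ) x) = fun x => c * (P x * φ x) :=
      funext fun x => mul_left_comm _ _ _
    rw [mem_ofPred_eq, e, integral_const_mul, hφ.2, mul_zero]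
    exact ⟨hφ.1.const_mul c, rfl⟩

theorem symmDefect_mem_annihilator (hP : LocallyIntegrable P)
    (hsymm : ∀ u, IsTestFunction u → ∀ j : ℕ,
      form univ P (apply n a u) (fun x => x ^ j) = form univ P u (apply n a fun x => x ^ j))
    (hu : IsTestFunction u) (i j : ℕ) : symmDefect n a u i j ∈ annihilator P := by
  have hv := hu.smooth_mul (f := fun x => x ^ i) (contDiff_id.pow i)
  have hj : ContDiff ℝ ∞ fun x : ℝ => x ^ j := contDiff_id.pow j
  have h₁ := ((hv.apply n a).smooth_mul hj).integrable_mul hP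
  have h₂ := (hv.smooth_mul (contDiff_apply n a hj)).integrable_mul hP
  have e : (fun x => P x * symmDefect n a u i j x) =
      fun x => P x * (x ^ j * apply n a (fun t => t ^ i * u t) x) -
        P x * (apply n a (fun t => t ^ j) x * (x ^ i * u x)) := by
    funext x
    rw [symmDefect]
    ring
  refine ⟨e ▸ h₁.sub h₂, ?_⟩
  rw [e, integral_sub h₁ h₂, sub_eq_zero]
  have h := hsymm _ hv j
  simp only [form, setIntegral_univ] at h
  convert h using 3 <;> ring

theorem first_order_identity (a : ℕ → ℝ[X]) (hu : ContDiff ℝ ∞ u) :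
    symmDefect 4 a u 3 0 - (3 : ℝ) • symmDefect 4 a u 2 1 + (3 : ℝ) • symmDefect 4 a u 1 2 -
      symmDefect 4 a u 0 3 =
    (12 : ℝ) • fun x => 2 * (a 4).eval x * deriv u x + (a 3).eval x * u x := by
  funext x
  simp only [Pi.sub_apply, Pi.add_apply, Pi.smul_apply, smul_eq_mul, symmDefect,
    apply_pow_mul 4 a hu]
  simp only [apply, iteratedDeriv_pow, show Finset.Icc 1 4 = {1, 2, 3, 4} from rfl]
  simp [Finset.sum_range_succ, Nat.choose, Nat.descFactorial]
  ring

theorem second_order_identity (a : ℕ → ℝ[X]) (hu : ContDiff ℝ ∞ u) :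
    symmDefect 4 a u 1 0 - symmDefect 4 a u 0 1 =
      ((2 : ℝ) • fun x => 2 * (a 4).eval x * deriv (deriv (deriv u)) x +
        (a 3).eval x * deriv (deriv u) x) +
      fun x => (a 3).eval x * deriv (deriv u) x + 2 * (a 2).eval x * deriv u x +
        2 * (a 1).eval x * u x := by
  funext x
  simp only [Pi.sub_apply, Pi.add_apply, Pi.smul_apply, smul_eq_mul, symmDefect,
    apply_pow_mul 4 a hu]
  simp only [apply, iteratedDeriv_pow, show Finset.Icc 1 4 = {1, 2, 3, 4} from rfl]
  simp [Finset.sum_range_succ, Nat.choose, Nat.descFactorial, iteratedDeriv_succ]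
  ring

theorem first_order_mem_annihilator (hP : LocallyIntegrable P)
    (hsymm : ∀ u, IsTestFunction u → ∀ j : ℕ,
      form univ P (apply 4 a u) (fun x => x ^ j) = form univ P u (apply 4 a fun x => x ^ j))
    (hu : IsTestFunction u) :
    (fun x => 2 * (a 4).eval x * deriv u x + (a 3).eval x * u x) ∈ annihilator P := by
  have h := symmDefect_mem_annihilator hP hsymm hu
  rw [← (annihilator P).smul_mem_iff (show (12 : ℝ) ≠ 0 by norm_num),
    ← first_order_identity a hu.contDiff]
  exact sub_mem (add_mem (sub_mem (h 3 0) (Submodule.smul_mem _ _ (h 2 1)))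
    (Submodule.smul_mem _ _ (h 1 2))) (h 0 3)

theorem second_order_mem_annihilator (hP : LocallyIntegrable P)
    (hsymm : ∀ u, IsTestFunction u → ∀ j : ℕ,
      form univ P (apply 4 a u) (fun x => x ^ j) = form univ P u (apply 4 a fun x => x ^ j))
    (hu : IsTestFunction u) :
    (fun x => (a 3).eval x * deriv (deriv u) x + 2 * (a 2).eval x * deriv u x +
      2 * (a 1).eval x * u x) ∈ annihilator P := by
  have h := symmDefect_mem_annihilator hP hsymm hu
  rw [← (annihilator P).add_mem_iff_right (Submodule.smul_mem _ 2
    (first_order_mem_annihilator hP hsymm hu.deriv.deriv)), ← second_order_identity a hu.contDiff]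
  exact sub_mem (h 1 0) (h 0 1)

end WeakEquations

/-- The weak form of the determining equations `(2 a₄ P)' = a₃ P` and
`(a₃ P)'' - (2 a₂ P)' + 2 a₁ P = 0` of a weight `P`, as a first order system for continuous
representatives `y` of `2 a₄ P` and `z` of `a₃ P` and an auxiliary function `w`. -/
structure DeterminingSystem (a : ℕ → ℝ[X]) (P y z w : ℝ → ℝ) : Prop where
  ae_eq_y : (fun x => 2 * (a 4).eval x * P x) =ᵐ[volume] y
  ae_eq_z : (fun x => (a 3).eval x * P x) =ᵐ[volume] z
  primitive_y : IsPrimitive y fun x => (a 3).eval x * P x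
  primitive_z : IsPrimitive z fun x => 2 * (a 2).eval x * P x - w x
  primitive_w : IsPrimitive w fun x => 2 * (a 1).eval x * P x

section DeterminingSystem

variable {a : ℕ → ℝ[X]} {P y z w : ℝ → ℝ}

theorem exists_determiningSystem (hP : LocallyIntegrable P)
    (hsymm : ∀ u, IsTestFunction u → ∀ j : ℕ,
      form univ P (apply 4 a u) (fun x => x ^ j) = form univ P u (apply 4 a fun x => x ^ j)) :
    ∃ y z w, DeterminingSystem a P y z w := by
  have hloc : ∀ (c : ℝ) (q : ℝ[X]), LocallyIntegrable fun x => c * q.eval x * P x := fun c q => by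
    simpa only [smul_eq_mul, mul_assoc] using
      hP.continuous_smul (g := fun x => c * q.eval x) (continuous_const.mul q.continuous)
  have hloc₃ : LocallyIntegrable fun x => (a 3).eval x * P x := by
    simpa only [one_mul] using hloc 1 (a 3)
  obtain ⟨y, hy, hPy⟩ := exists_isPrimitive_of_weak_first_order (hloc 2 (a 4)) hloc₃ fun u hu => by
    convert (first_order_mem_annihilator hP hsymm hu).2 using 3
    ring
  obtain ⟨w, z, hw, hz, hPz⟩ := exists_isPrimitive_of_weak_second_order hloc₃ (hloc 2 (a 2))
    (hloc 2 (a 1)) fun u hu => by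
      convert (second_order_mem_annihilator hP hsymm hu).2 using 3
      ring
  exact ⟨y, z, w, hPy, hPz, hy, hz, hw⟩

/-- The polynomial `d` with `4 a₄² w = d y`, by which `w` is eliminated from the system. -/
noncomputable def elimPoly (a : ℕ → ℝ[X]) : ℝ[X] :=
  2 * a 3 * derivative (a 4) - 2 * derivative (a 3) * a 4 + 4 * a 2 * a 4 - a 3 ^ 2

namespace DeterminingSystem

theorem two_mul_eq (h : DeterminingSystem a P y z w) (x : ℝ) :
    2 * (a 4).eval x * z x = (a 3).eval x * y x := by
  have hae : (fun x => 2 * (a 4).eval x * z x) =ᵐ[volume] fun x => (a 3).eval x * y x := by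
    filter_upwards [h.ae_eq_y, h.ae_eq_z] with t hy hz
    rw [← hy, ← hz]
    ring
  have hz := h.primitive_z.continuous
  have hy := h.primitive_y.continuous
  exact congrFun ((Continuous.ae_eq_iff_eq volume (by fun_prop) (by fun_prop)).1 hae) x

theorem hasDerivAt_y (h : DeterminingSystem a P y z w) (x : ℝ) : HasDerivAt y (z x) x :=
  h.primitive_y.hasDerivAt_of_continuous h.ae_eq_z h.primitive_z.continuous x

theorem hasDerivAt_z_w (h : DeterminingSystem a P y z w) {U : Set ℝ} (hU : IsOpen U) {q : ℝ → ℝ}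
    (hPq : P =ᵐ[volume.restrict U] q) (hq : ContinuousOn q U) {x : ℝ} (hx : x ∈ U) :
    HasDerivAt z (2 * (a 2).eval x * q x - w x) x ∧ HasDerivAt w (2 * (a 1).eval x * q x) x := by
  have hw := h.primitive_w.continuous
  refine ⟨h.primitive_z.hasDerivAt_of_ae_eq (g := fun x => 2 * (a 2).eval x * q x - w x)
    hU ?_ (by fun_prop) hx, h.primitive_w.hasDerivAt_of_ae_eq
    (g := fun x => 2 * (a 1).eval x * q x) hU ?_ (by fun_prop) hx⟩
  all_goals filter_upwards [hPq] with t ht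
  all_goals rw [ht]

theorem hasDerivAt_of_eval_four_ne_zero (h : DeterminingSystem a P y z w) {x : ℝ}
    (hx : (a 4).eval x ≠ 0) :
    HasDerivAt z ((a 2).eval x * (y x / (a 4).eval x) - w x) x ∧
      HasDerivAt w ((a 1).eval x * (y x / (a 4).eval x)) x := by
  have hU : IsOpen {x | (a 4).eval x ≠ 0} := isOpen_ne_fun (a 4).continuous continuous_const
  have hy := h.primitive_y.continuous
  have hae : P =ᵐ[volume.restrict {x | (a 4).eval x ≠ 0}] fun x => y x / (2 * (a 4).eval x) := by
    filter_upwards [ae_restrict_of_ae h.ae_eq_y, ae_restrict_mem hU.measurableSet] with t ht ht0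
    rw [← ht, mul_div_cancel_left₀ _ (mul_ne_zero two_ne_zero ht0)]
  obtain ⟨hz, hw⟩ := h.hasDerivAt_z_w hU hae (hy.continuousOn.div (by fun_prop)
    fun t ht => mul_ne_zero two_ne_zero ht) hx
  have hhalf : ∀ b, 2 * b * (y x / (2 * (a 4).eval x)) = b * (y x / (a 4).eval x) := fun b => by
    field_simp
  exact ⟨hhalf ((a 2).eval x) ▸ hz, hhalf ((a 1).eval x) ▸ hw⟩

theorem hasDerivAt_of_eval_three_ne_zero (h : DeterminingSystem a P y z w) {x : ℝ}
    (hx : (a 3).eval x ≠ 0) :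
    HasDerivAt z (2 * (a 2).eval x * (z x / (a 3).eval x) - w x) x ∧
      HasDerivAt w (2 * (a 1).eval x * (z x / (a 3).eval x)) x := by
  have hU : IsOpen {x | (a 3).eval x ≠ 0} := isOpen_ne_fun (a 3).continuous continuous_const
  refine h.hasDerivAt_z_w hU (q := fun x => z x / (a 3).eval x) ?_
    (h.primitive_z.continuous.continuousOn.div (a 3).continuousOn fun t ht => ht) hx
  filter_upwards [ae_restrict_of_ae h.ae_eq_z, ae_restrict_mem hU.measurableSet] with t ht ht0
  rw [← ht, mul_div_cancel_left₀ _ ht0]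

theorem four_mul_sq_mul_w (h : DeterminingSystem a P y z w) {x : ℝ} (hx : (a 4).eval x ≠ 0) :
    4 * (a 4).eval x ^ 2 * w x = (elimPoly a).eval x * y x := by
  have hz := (h.hasDerivAt_of_eval_four_ne_zero hx).1
  have hderiv := (((((a 4).hasDerivAt x).const_mul 2).fun_mul hz).unique
    (((a 3).hasDerivAt x).fun_mul (h.hasDerivAt_y x) |>.congr_of_eventuallyEq
      (.of_forall h.two_mul_eq)))
  have hyz := h.two_mul_eq x
  field_simp at hderiv
  simp only [elimPoly, eval_add, eval_sub, eval_mul, eval_pow, eval_ofNat]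
  linear_combination (2 * (derivative (a 4)).eval x - (a 3).eval x) * hyz -
    2 * (a 4).eval x * hderiv

theorem compatibility_mul_eq_zero (h : DeterminingSystem a P y z w) {x : ℝ}
    (hx : (a 4).eval x ≠ 0) :
    (8 * a 1 * a 4 ^ 2 - 2 * a 4 * derivative (elimPoly a) -
      elimPoly a * (a 3 - 4 * derivative (a 4))).eval x * y x = 0 := by
  have hw := (h.hasDerivAt_of_eval_four_ne_zero hx).2
  have hnhds : ∀ᶠ t in 𝓝 x, 4 * (a 4).eval t ^ 2 * w t = (elimPoly a).eval t * y t :=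
    ((a 4).continuousAt.eventually_ne hx).mono fun t ht => h.four_mul_sq_mul_w ht
  have hderiv := ((((a 4).hasDerivAt x).fun_pow 2).const_mul 4 |>.fun_mul hw).unique
    (((elimPoly a).hasDerivAt x).fun_mul (h.hasDerivAt_y x) |>.congr_of_eventuallyEq hnhds)
  have hyz := h.two_mul_eq x
  have hwy := h.four_mul_sq_mul_w hx
  field_simp at hderiv
  simp only [eval_sub, eval_mul, eval_pow, eval_ofNat]
  linear_combination 2 * (a 4).eval x * hderiv + (elimPoly a).eval x * hyz -
    4 * (derivative (a 4)).eval x * hwy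

theorem exists_mem_y_ne_zero (h : DeterminingSystem a P y z w) (ha : a 4 ≠ 0) {U : Set ℝ}
    (hU : IsOpen U) (hPU : ¬ P =ᵐ[volume.restrict U] 0) : ∃ x ∈ U, (a 4).eval x ≠ 0 ∧ y x ≠ 0 := by
  contrapose! hPU
  have hroots : ∀ᵐ x ∂volume.restrict U, (a 4).eval x ≠ 0 := ae_restrict_of_ae <|
    measure_eq_zero_iff_ae_notMem.1 (Set.Finite.measure_zero (finite_setOfPred_isRoot ha) volume)
  filter_upwards [ae_restrict_of_ae h.ae_eq_y, hroots, ae_restrict_mem hU.measurableSet]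
    with x hxy hx hxU
  rw [hPU x hxU hx] at hxy
  simpa [hx] using hxy

theorem compatibility (h : DeterminingSystem a P y z w) (ha : a 4 ≠ 0) (hP : ¬ P =ᵐ[volume] 0) :
    8 * a 1 * a 4 ^ 2 - 2 * a 4 * derivative (elimPoly a) =
      elimPoly a * (a 3 - 4 * derivative (a 4)) := by
  obtain ⟨x, -, hx, hyx⟩ := h.exists_mem_y_ne_zero ha isOpen_univ (by rwa [Measure.restrict_univ])
  refine sub_eq_zero.1 (eq_zero_of_infinite_isRoot _ (infinite_of_mem_nhds x ?_))
  filter_upwards [(a 4).continuousAt.eventually_ne hx,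
    h.primitive_y.continuous.continuousAt.eventually_ne hyx] with t ht hyt
  exact (mul_eq_zero.1 (h.compatibility_mul_eq_zero ht)).resolve_right hyt

theorem eq_zero_of_mem_closure (h : DeterminingSystem a P y z w) {U : Set ℝ} (hU : IsOpen U)
    (hPU : P =ᵐ[volume.restrict U] 0) {x : ℝ} (hx : x ∈ closure U) :
    y x = 0 ∧ z x = 0 ∧ w x = 0 := by
  have hyc := h.primitive_y.continuous
  have hzc := h.primitive_z.continuous
  have hy : EqOn y 0 U := by
    refine Measure.eqOn_open_of_ae_eq (μ := volume) ?_ hU hyc.continuousOn continuousOn_const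
    filter_upwards [ae_restrict_of_ae h.ae_eq_y, hPU] with t ht hPt
    rw [← ht, hPt, Pi.zero_apply, mul_zero]
  have hz : EqOn z 0 U := fun t ht =>
    (h.hasDerivAt_y t).unique ((hasDerivAt_const t (0 : ℝ)).congr_of_eventuallyEq
      (hy.eventuallyEq_of_mem (hU.mem_nhds ht)))
  have hw : EqOn w 0 U := fun t ht => by
    have := (h.hasDerivAt_z_w hU hPU continuousOn_const ht).1.unique
      ((hasDerivAt_const t (0 : ℝ)).congr_of_eventuallyEq
        (hz.eventuallyEq_of_mem (hU.mem_nhds ht)))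
    simpa using this
  exact ⟨hy.closure hyc continuous_const hx, hz.closure hzc continuous_const hx,
    hw.closure h.primitive_w.continuous continuous_const hx⟩

end DeterminingSystem

theorem eventually_eq_zero_of_hasDerivAt_linear {E : Type*} [NormedAddCommGroup E]
    [NormedSpace ℝ E] {A : ℝ → E →L[ℝ] E} {f : ℝ → E} {r : ℝ} (hA : ContinuousAt A r)
    (hf : ∀ᶠ t in 𝓝 r, HasDerivAt f (A t (f t)) t) (h0 : f r = 0) : f =ᶠ[𝓝 r] 0 := by
  have hlip : ∀ᶠ t in 𝓝 r, LipschitzOnWith (‖A r‖₊ + 1) (A t) univ := by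
    filter_upwards [hA.nnnorm.eventually_lt continuousAt_const (lt_add_one ‖A r‖₊)] with t ht
    exact ((A t).lipschitz.weaken ht.le).lipschitzOnWith
  refine ODE_solution_unique_of_eventually (v := fun t => A t) (s := fun _ => univ) hlip
    (hf.mono fun t ht => ⟨ht, mem_univ _⟩) (.of_forall fun t => ⟨?_, mem_univ _⟩) h0
  simpa only [Pi.zero_apply, map_zero] using! hasDerivAt_const t (0 : E)

namespace DeterminingSystem

variable {r : ℝ}

theorem not_eventually_y_eq_zero (h : DeterminingSystem a P y z w) (ha : a 4 ≠ 0)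
    (hr : ∀ U, IsOpen U → r ∈ U → ¬ P =ᵐ[volume.restrict U] 0) : ¬ y =ᶠ[𝓝 r] 0 := fun hy => by
  obtain ⟨U, hUy, hU, hrU⟩ := mem_nhds_iff.1 hy
  obtain ⟨x, hxU, -, hx⟩ := h.exists_mem_y_ne_zero ha hU (hr U hU hrU)
  exact hx (hUy hxU)

theorem eval_three_eq_zero (h : DeterminingSystem a P y z w) (ha : a 4 ≠ 0)
    (hr : ∀ U, IsOpen U → r ∈ U → ¬ P =ᵐ[volume.restrict U] 0) (hz : z r = 0) (hw : w r = 0) :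
    (a 3).eval r = 0 := by
  by_contra h3
  open ContinuousLinearMap in
  let A : ℝ → ℝ × ℝ →L[ℝ] ℝ × ℝ := fun t =>
    (2 * (a 2).eval t / (a 3).eval t) • (inl ℝ ℝ ℝ ∘L fst ℝ ℝ ℝ) - inl ℝ ℝ ℝ ∘L snd ℝ ℝ ℝ +
      (2 * (a 1).eval t / (a 3).eval t) • (inr ℝ ℝ ℝ ∘L fst ℝ ℝ ℝ)
  have hA : ContinuousAt A r := by
    fun_prop (disch := assumption)
  have hzw := eventually_eq_zero_of_hasDerivAt_linear (f := fun t => (z t, w t)) hA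
    (by
      filter_upwards [(a 3).continuousAt.eventually_ne h3] with t ht
      obtain ⟨hz, hw⟩ := h.hasDerivAt_of_eval_three_ne_zero ht
      have hval : A t (z t, w t) = (2 * (a 2).eval t * (z t / (a 3).eval t) - w t,
          2 * (a 1).eval t * (z t / (a 3).eval t)) := by
        simp [A, mul_div_assoc, mul_div_left_comm, mul_comm]
      rw [hval]
      exact hz.prodMk hw) (Prod.ext hz hw)
  refine h.not_eventually_y_eq_zero ha hr ?_
  filter_upwards [hzw, (a 3).continuousAt.eventually_ne h3] with t ht ht3
  have hyz := h.two_mul_eq t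
  rw [(Prod.mk.inj ht).1, mul_zero] at hyz
  exact (mul_eq_zero.1 hyz.symm).resolve_left ht3

theorem not_pow_rootMultiplicity_dvd (h : DeterminingSystem a P y z w) (ha : a 4 ≠ 0)
    (hr : ∀ U, IsOpen U → r ∈ U → ¬ P =ᵐ[volume.restrict U] 0) (hy : y r = 0) (hz : z r = 0) :
    ¬ (X - C r) ^ (a 4).rootMultiplicity r ∣ a 3 := by
  rintro ⟨k, hk⟩
  obtain ⟨q, hq, hqr⟩ := exists_eq_pow_rootMultiplicity_mul_and_not_dvd (a 4) ha r
  rw [dvd_iff_isRoot] at hqr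
  set m := (a 4).rootMultiplicity r
  refine h.not_eventually_y_eq_zero ha hr (eventually_eq_zero_of_hasDerivAt_linear
    (A := fun t => (k.eval t / (2 * q.eval t)) • ContinuousLinearMap.id ℝ ℝ) ?_ ?_ hy)
  · have hqr' := mul_ne_zero two_ne_zero hqr
    fun_prop (disch := assumption)
  · filter_upwards [q.continuousAt.eventually_ne hqr] with t ht
    have hval : k.eval t / (2 * q.eval t) * y t = z t := by
      rcases eq_or_ne t r with rfl | htr
      · rw [hy, hz, mul_zero]
      · have hyz := h.two_mul_eq t
        simp only [hk, hq, eval_mul, eval_pow, eval_sub, eval_X, eval_C] at hyz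
        have := pow_ne_zero m (sub_ne_zero.2 htr)
        field_simp
        refine mul_left_cancel₀ this ?_
        linear_combination -hyz
    simpa only [smul_apply, ContinuousLinearMap.id_apply, smul_eq_mul, hval]
      using h.hasDerivAt_y t

theorem rootMultiplicity_three_lt (h : DeterminingSystem a P y z w) (ha : a 4 ≠ 0)
    (hr : ∀ U, IsOpen U → r ∈ U → ¬ P =ᵐ[volume.restrict U] 0)
    (hyzw : y r = 0 ∧ z r = 0 ∧ w r = 0) :
    0 < (a 3).rootMultiplicity r ∧ (a 3).rootMultiplicity r < (a 4).rootMultiplicity r := by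
  obtain ⟨hy, hz, hw⟩ := hyzw
  have hndvd := h.not_pow_rootMultiplicity_dvd ha hr hy hz
  have h3 : a 3 ≠ 0 := fun h3 => hndvd (h3 ▸ dvd_zero _)
  exact ⟨(rootMultiplicity_pos h3).2 (h.eval_three_eq_zero ha hr hz hw),
    not_le.1 fun hle => hndvd ((le_rootMultiplicity_iff h3).1 hle)⟩

end DeterminingSystem

theorem not_integrable_of_neg_le_atTop {y z : ℝ → ℝ} {N : ℕ}
    (hy : ∀ᶠ t in atTop, HasDerivAt y (z t) t)
    (hN : ∀ᶠ t in atTop, -N * y t ^ 2 ≤ t * (z t * y t)) (h0 : ∃ᶠ t in atTop, y t ≠ 0) :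
    ¬ Integrable fun t => t ^ N * y t := fun hint => by
  obtain ⟨R, hR⟩ := eventually_atTop.1 (hy.and (hN.and (eventually_gt_atTop 0)))
  obtain ⟨x₀, hx₀, hyx₀⟩ := frequently_atTop.1 h0 R
  have hderiv : ∀ t ∈ Ici x₀, HasDerivAt (fun t => (t ^ N * y t) ^ 2)
      (2 * (t ^ N * y t) * (N * t ^ (N - 1) * y t + t ^ N * z t)) t := fun t ht => by
    simpa using ((hasDerivAt_pow N t).fun_mul (hR t (hx₀.trans ht)).1).fun_pow 2
  have hmono : MonotoneOn (fun t => (t ^ N * y t) ^ 2) (Ici x₀) := by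
    refine monotoneOn_of_hasDerivWithinAt_nonneg (convex_Ici x₀)
      (fun t ht => (hderiv t ht).continuousAt.continuousWithinAt)
      (fun t ht => (hderiv t (interior_subset ht)).hasDerivWithinAt) fun t ht => ?_
    obtain ⟨-, hNt, htpos⟩ := hR t (hx₀.trans (interior_subset ht))
    have hpow : t * (N * t ^ (N - 1)) = N * t ^ N := by
      cases N <;> simp [pow_succ', mul_left_comm]
    refine (mul_nonneg_iff_of_pos_left htpos).1 ?_
    calc (0 : ℝ) ≤ 2 * (t ^ N) ^ 2 * (N * y t ^ 2 + t * (z t * y t)) :=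
          mul_nonneg (by positivity) (by linarith)
      _ = t * (2 * (t ^ N * y t) * (N * t ^ (N - 1) * y t + t ^ N * z t)) := by
          linear_combination (-2 * t ^ N * y t ^ 2) * hpow
  have hc : 0 < |x₀ ^ N * y x₀| :=
    abs_pos.2 (mul_ne_zero (pow_ne_zero N (hR x₀ hx₀).2.2.ne') hyx₀)
  have hfin := (hint.integrableOn (s := Ici x₀)).measure_norm_ge_lt_top hc
  have hsub : Ici x₀ ⊆ {t | |x₀ ^ N * y x₀| ≤ ‖t ^ N * y t‖} := fun t ht =>
    sq_le_sq.1 (hmono self_mem_Ici ht ht)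
  rw [Measure.restrict_apply_superset hsub] at hfin
  exact hfin.ne Real.volume_Ici

theorem not_integrable_of_neg_le_atBot {y z : ℝ → ℝ} {N : ℕ}
    (hy : ∀ᶠ t in atBot, HasDerivAt y (z t) t)
    (hN : ∀ᶠ t in atBot, -N * y t ^ 2 ≤ t * (z t * y t)) (h0 : ∃ᶠ t in atBot, y t ≠ 0) :
    ¬ Integrable fun t => t ^ N * y t := fun hint => by
  refine not_integrable_of_neg_le_atTop (y := fun t => y (-t)) (z := fun t => -z (-t)) (N := N)
    ?_ ?_ ?_ ?_
  · filter_upwards [tendsto_neg_atTop_atBot.eventually hy] with t ht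
    simpa using! HasDerivAt.scomp t ht (hasDerivAt_neg t)
  · filter_upwards [tendsto_neg_atTop_atBot.eventually hN] with t ht
    linarith
  · rw [← neg_atTop] at h0
    exact h0
  · refine (hint.comp_neg.const_mul ((-1) ^ N)).congr (.of_forall fun t => ?_)
    simp only [← mul_assoc, ← mul_pow, neg_one_mul, neg_neg]

namespace DeterminingSystem

theorem integrable_pow_mul_y (h : DeterminingSystem a P y z w)
    (hmom : ∀ q : ℝ[X], Integrable fun x => P x * q.eval x) (N : ℕ) :
    Integrable fun x => x ^ N * y x := by
  refine (hmom (2 * X ^ N * a 4)).congr ?_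
  filter_upwards [h.ae_eq_y] with x hx
  rw [← hx]
  simp only [eval_mul, eval_pow, eval_X, eval_ofNat]
  ring

theorem neg_mul_sq_le (h : DeterminingSystem a P y z w) {t N : ℝ} (ht : (a 4).eval t ≠ 0)
    (hN : -N ≤ t * ((a 3).eval t / (2 * (a 4).eval t))) : -N * y t ^ 2 ≤ t * (z t * y t) := by
  have hz : z t = (a 3).eval t / (2 * (a 4).eval t) * y t := by
    have := h.two_mul_eq t
    field_simp
    linarith
  calc -N * y t ^ 2 ≤ t * ((a 3).eval t / (2 * (a 4).eval t)) * y t ^ 2 := by gcongr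
    _ = t * (z t * y t) := by rw [hz]; ring

theorem exists_Ioi_ae_eq_zero (h : DeterminingSystem a P y z w) (ha : a 4 ≠ 0)
    (hmom : ∀ q : ℝ[X], Integrable fun x => P x * q.eval x) {N : ℕ}
    (hN : ∀ᶠ t in atTop, -(N : ℝ) ≤ t * ((a 3).eval t / (2 * (a 4).eval t))) :
    ∃ R, P =ᵐ[volume.restrict (Ioi R)] 0 := by
  by_contra! hP
  refine not_integrable_of_neg_le_atTop (.of_forall h.hasDerivAt_y) ?_ ?_
    (h.integrable_pow_mul_y hmom N)
  · filter_upwards [hN, eventually_atTop_not_isRoot _ ha] with t ht h4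
    exact h.neg_mul_sq_le h4 ht
  · refine frequently_atTop'.2 fun R => ?_
    obtain ⟨x, hx, -, hyx⟩ := h.exists_mem_y_ne_zero ha isOpen_Ioi (hP R)
    exact ⟨x, hx, hyx⟩

theorem exists_Iio_ae_eq_zero (h : DeterminingSystem a P y z w) (ha : a 4 ≠ 0)
    (hmom : ∀ q : ℝ[X], Integrable fun x => P x * q.eval x) {N : ℕ}
    (hN : ∀ᶠ t in atBot, -(N : ℝ) ≤ t * ((a 3).eval t / (2 * (a 4).eval t))) :
    ∃ R, P =ᵐ[volume.restrict (Iio R)] 0 := by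
  by_contra! hP
  refine not_integrable_of_neg_le_atBot (.of_forall h.hasDerivAt_y) ?_ ?_
    (h.integrable_pow_mul_y hmom N)
  · filter_upwards [hN, eventually_atBot_not_isRoot _ ha] with t ht h4
    exact h.neg_mul_sq_le h4 ht
  · refine frequently_atBot'.2 fun R => ?_
    obtain ⟨x, hx, -, hyx⟩ := h.exists_mem_y_ne_zero ha isOpen_Iio (hP R)
    exact ⟨x, hx, hyx⟩

end DeterminingSystem

end DeterminingSystem

section Degrees

theorem exists_nat_forall_neg_le_mul_div {p q : ℝ[X]} (hpq : p.natDegree < q.natDegree) :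
    ∃ N : ℕ, ∀ᶠ t in Bornology.cobounded ℝ, -(N : ℝ) ≤ t * (p.eval t / (2 * q.eval t)) := by
  have hdeg : (X * p).degree ≤ q.degree := by
    rw [degree_eq_natDegree (ne_zero_of_natDegree_gt hpq)]
    refine degree_le_of_natDegree_le ((natDegree_mul_le_of_le natDegree_X_le le_rfl).trans ?_)
    rwa [add_comm]
  obtain ⟨c, hc⟩ := (isBigO_cobounded_of_degree_le hdeg).bound
  obtain ⟨N, hN⟩ := exists_nat_ge c
  refine ⟨N, hc.mono fun t ht => (abs_le.1 ?_).1⟩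
  rw [← mul_div_assoc, abs_div]
  refine div_le_of_le_mul₀ (abs_nonneg _) N.cast_nonneg ?_
  calc |t * p.eval t| ≤ c * |q.eval t| := by simpa only [eval_mul, eval_X] using! ht
    _ ≤ N * (2 * |q.eval t|) := by
      gcongr
      linarith [abs_nonneg (q.eval t)]
    _ = N * |2 * q.eval t| := by rw [abs_mul, abs_two]

theorem nonneg_mul_div_atTop_or_atBot {p q : ℝ[X]} (hp : p ≠ 0)
    (hpq : p.degree = q.degree) :
    (∀ᶠ t in atTop, 0 ≤ t * (p.eval t / (2 * q.eval t))) ∨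
      ∀ᶠ t in atBot, 0 ≤ t * (p.eval t / (2 * q.eval t)) := by
  have hq : q ≠ 0 := by rwa [← degree_ne_bot, ← hpq, degree_ne_bot]
  have hval : ∀ t, t * (p.eval t / (2 * q.eval t)) = t * (p.eval t / q.eval t) / 2 := fun t => by
    ring
  simp only [hval]
  rcases (div_ne_zero (leadingCoeff_ne_zero.2 hp) (leadingCoeff_ne_zero.2 hq)).lt_or_gt with hc | hc
  · right
    filter_upwards [eventually_lt_atBot 0,
      (div_tendsto_atBot_leadingCoeff_div_of_degree_eq p q hpq).eventually_lt_const hc]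
      with t ht hlt
    exact (half_pos (mul_pos_of_neg_of_neg ht hlt)).le
  · left
    filter_upwards [eventually_gt_atTop 0,
      (div_tendsto_atTop_leadingCoeff_div_of_degree_eq p q hpq).eventually_const_lt hc]
      with t ht hlt
    exact (half_pos (mul_pos ht hlt)).le

variable {a : ℕ → ℝ[X]}

theorem natDegree_elimPoly (h2 : (a 2).natDegree ≤ 2) (h3 : 2 < (a 3).natDegree)
    (h4 : (a 4).natDegree ≤ (a 3).natDegree) : (elimPoly a).natDegree = 2 * (a 3).natDegree := by
  have h3' := natDegree_derivative_le (a 3)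
  have h4' := natDegree_derivative_le (a 4)
  rw [elimPoly, natDegree_sub_eq_right_of_natDegree_lt, natDegree_pow]
  refine lt_of_le_of_lt (b := 2 * (a 3).natDegree - 1) ?_ (by rw [natDegree_pow]; omega)
  have hmul : ∀ (c : ℝ) (p q : ℝ[X]), p.natDegree + q.natDegree ≤ 2 * (a 3).natDegree - 1 →
    (C c * p * q).natDegree ≤ 2 * (a 3).natDegree - 1 := fun c p q hpq =>
      natDegree_mul_le.trans ((Nat.add_le_add_right (natDegree_C_mul_le c p) _).trans hpq)
  exact natDegree_add_le_of_degree_le (natDegree_sub_le_of_le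
    (hmul 2 _ _ (by omega)) (hmul 2 _ _ (by omega)) |>.trans (max_self _).le)
    (hmul 4 _ _ (by omega))

theorem natDegree_three_lt_or_eq_two
    (h : 8 * a 1 * a 4 ^ 2 - 2 * a 4 * derivative (elimPoly a) =
      elimPoly a * (a 3 - 4 * derivative (a 4)))
    (h1 : (a 1).natDegree ≤ 1) (h2 : (a 2).natDegree ≤ 2) (h4 : 2 ≤ (a 4).natDegree) :
    (a 3).natDegree < (a 4).natDegree ∨ (a 3).natDegree = 2 ∧ (a 4).natDegree = 2 := by
  by_contra! hcon
  obtain ⟨h43, hne⟩ := hcon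
  have h3 : 2 < (a 3).natDegree := by omega
  have hd := natDegree_elimPoly h2 h3 h43
  have hd' := natDegree_derivative_le (elimPoly a)
  have h4' := natDegree_derivative_le (a 4)
  have hfactor : (a 3 - 4 * derivative (a 4)).natDegree = (a 3).natDegree :=
    natDegree_sub_eq_left_of_natDegree_lt ((natDegree_C_mul_le 4 _).trans_lt (by omega))
  have hright : (elimPoly a * (a 3 - 4 * derivative (a 4))).natDegree = 3 * (a 3).natDegree := by
    rw [natDegree_mul (ne_zero_of_natDegree_gt (n := 0) (by omega))
      (ne_zero_of_natDegree_gt (n := 0) (by omega)), hd, hfactor]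
    ring
  have hleft : (8 * a 1 * a 4 ^ 2 - 2 * a 4 * derivative (elimPoly a)).natDegree ≤
      3 * (a 3).natDegree - 1 := by
    refine (natDegree_sub_le_of_le (natDegree_mul_le_of_le (natDegree_C_mul_le 8 _)
      natDegree_pow_le) (natDegree_mul_le_of_le (natDegree_C_mul_le 2 _) hd')).trans ?_
    omega
  rw [h, hright] at hleft
  omega

theorem sum_rootMultiplicity_le_natDegree {R : Type*} [CommRing R] [IsDomain R] (q : R[X])
    (s : Finset R) : ∑ x ∈ s, q.rootMultiplicity x ≤ q.natDegree := by
  classical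
  calc ∑ x ∈ s, q.rootMultiplicity x = ∑ x ∈ s, q.roots.count x := by simp only [count_roots]
    _ ≤ ∑ x ∈ q.roots.toFinset, q.roots.count x := Finset.sum_le_sum_of_ne_zero fun x _ hx =>
        Multiset.mem_toFinset.2 (Multiset.count_ne_zero.1 hx)
    _ = q.roots.card := Multiset.toFinset_sum_count_eq _
    _ ≤ q.natDegree := card_roots' q

theorem rootMultiplicity_add_le_natDegree {R : Type*} [CommRing R] [IsDomain R] (q : R[X])
    {l r : R} (hlr : l ≠ r) : q.rootMultiplicity l + q.rootMultiplicity r ≤ q.natDegree := by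
  classical
  simpa only [Finset.sum_pair hlr] using sum_rootMultiplicity_le_natDegree q {l, r}

theorem isRoot_iff_of_natDegree_le_rootMultiplicity_add {R : Type*} [CommRing R] [IsDomain R]
    {q : R[X]} (hq : q ≠ 0) {l r s : R} (hlr : l ≠ r) (hl : q.IsRoot l) (hr : q.IsRoot r)
    (hdeg : q.natDegree ≤ q.rootMultiplicity l + q.rootMultiplicity r) :
    q.IsRoot s ↔ s = l ∨ s = r := by
  classical
  refine ⟨fun hs => ?_, by rintro (rfl | rfl) <;> assumption⟩
  by_contra! hne
  have hsum := sum_rootMultiplicity_le_natDegree q {s, l, r}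
  rw [Finset.sum_insert (by simpa using hne), Finset.sum_pair hlr] at hsum
  have := (rootMultiplicity_pos hq).2 hs
  omega

end Degrees

section Endpoints

variable {a : ℕ → ℝ[X]} {I : Set ℝ} {p y z w : ℝ → ℝ}

theorem csSup_mem_frontier (hI : I.Nonempty) (hbdd : BddAbove I) : sSup I ∈ frontier I :=
  ⟨csSup_mem_closure hI hbdd, fun hmem => by
    have := interior_mono (show I ⊆ Iic (sSup I) from fun x hx => le_csSup hbdd hx) hmem
    rw [interior_Iic, mem_Iio] at this
    exact lt_irrefl _ this⟩

theorem csInf_mem_frontier (hI : I.Nonempty) (hbdd : BddBelow I) : sInf I ∈ frontier I :=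
  ⟨csInf_mem_closure hI hbdd, fun hmem => by
    have := interior_mono (show I ⊆ Ici (sInf I) from fun x hx => csInf_le hbdd hx) hmem
    rw [interior_Ici, mem_Ioi] at this
    exact lt_irrefl _ this⟩

/-- Nondegeneracy of a weight `p` on `I`: it is not almost everywhere zero on any nonempty open
subset of `I`. -/
def NowhereAEZero (I : Set ℝ) (p : ℝ → ℝ) : Prop :=
  ∀ U ⊆ I, IsOpen U → U.Nonempty → ¬ p =ᵐ[volume.restrict U] 0

theorem NowhereAEZero.not_indicator_ae_eq_zero (hp : NowhereAEZero I p) {U : Set ℝ}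
    (hU : IsOpen U) (hUI : (U ∩ interior I).Nonempty) :
    ¬ I.indicator p =ᵐ[volume.restrict U] 0 := fun h => by
  have hsub : U ∩ interior I ⊆ I := inter_subset_right.trans interior_subset
  have hopen := hU.inter (isOpen_interior (s := I))
  refine hp _ hsub hopen hUI ?_
  filter_upwards [ae_restrict_of_ae_restrict_of_subset inter_subset_left h,
    ae_restrict_mem hopen.measurableSet] with x hx hxU
  rwa [indicator_of_mem (hsub hxU)] at hx

theorem indicator_ae_eq_zero_interior_compl :
    I.indicator p =ᵐ[volume.restrict (interior Iᶜ)] 0 := by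
  filter_upwards [ae_restrict_mem isOpen_interior.measurableSet] with x hx
  exact indicator_of_notMem (interior_subset hx) p

namespace DeterminingSystem

theorem rootMultiplicity_three_lt_of_mem_frontier (h : DeterminingSystem a (I.indicator p) y z w)
    (ha : a 4 ≠ 0) (hI : Convex ℝ I) (hne : (interior I).Nonempty)
    (hp : NowhereAEZero I p) {r : ℝ} (hr : r ∈ frontier I) :
    0 < (a 3).rootMultiplicity r ∧ (a 3).rootMultiplicity r < (a 4).rootMultiplicity r := by
  have hmeets : r ∈ closure (interior I) := by
    rw [hI.closure_interior_eq_closure_of_nonempty_interior hne]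
    exact hr.1
  have hmeets_compl : r ∈ closure (interior Iᶜ) := by
    rw [interior_compl, closure_compl, hI.interior_closure_eq_interior_of_nonempty_interior hne]
    exact hr.2
  exact h.rootMultiplicity_three_lt ha
    (fun U hU hrU => hp.not_indicator_ae_eq_zero hU (mem_closure_iff.1 hmeets U hU hrU))
    (h.eq_zero_of_mem_closure isOpen_interior indicator_ae_eq_zero_interior_compl hmeets_compl)

theorem bddAbove_of_neg_le (h : DeterminingSystem a (I.indicator p) y z w) (ha : a 4 ≠ 0)
    (hI : I.OrdConnected) (hp : NowhereAEZero I p)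
    (hmom : ∀ q : ℝ[X], Integrable fun x => I.indicator p x * q.eval x) {N : ℕ}
    (hN : ∀ᶠ t in atTop, -(N : ℝ) ≤ t * ((a 3).eval t / (2 * (a 4).eval t))) : BddAbove I := by
  by_contra hbdd
  obtain ⟨R, hR⟩ := h.exists_Ioi_ae_eq_zero ha hmom hN
  obtain ⟨x, hx, hRx⟩ := not_bddAbove_iff.1 hbdd R
  have hsub : Ioi x ⊆ I := fun t ht => by
    obtain ⟨b, hb, htb⟩ := not_bddAbove_iff.1 hbdd t
    exact hI.out hx hb ⟨ht.le, htb.le⟩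
  refine hp.not_indicator_ae_eq_zero isOpen_Ioi ?_
    (ae_restrict_of_ae_restrict_of_subset (Ioi_subset_Ioi hRx.le) hR)
  rw [inter_eq_left.2 (interior_maximal hsub isOpen_Ioi)]
  exact nonempty_Ioi

theorem bddBelow_of_neg_le (h : DeterminingSystem a (I.indicator p) y z w) (ha : a 4 ≠ 0)
    (hI : I.OrdConnected) (hp : NowhereAEZero I p)
    (hmom : ∀ q : ℝ[X], Integrable fun x => I.indicator p x * q.eval x) {N : ℕ}
    (hN : ∀ᶠ t in atBot, -(N : ℝ) ≤ t * ((a 3).eval t / (2 * (a 4).eval t))) : BddBelow I := by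
  by_contra hbdd
  obtain ⟨R, hR⟩ := h.exists_Iio_ae_eq_zero ha hmom hN
  obtain ⟨x, hx, hRx⟩ := not_bddBelow_iff.1 hbdd R
  have hsub : Iio x ⊆ I := fun t ht => by
    obtain ⟨b, hb, htb⟩ := not_bddBelow_iff.1 hbdd t
    exact hI.out hb hx ⟨htb.le, ht.le⟩
  refine hp.not_indicator_ae_eq_zero isOpen_Iio ?_
    (ae_restrict_of_ae_restrict_of_subset (Iio_subset_Iio hRx.le) hR)
  rw [inter_eq_left.2 (interior_maximal hsub isOpen_Iio)]
  exact nonempty_Iio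

theorem frontier_nonempty_of_natDegree_eq (h : DeterminingSystem a (I.indicator p) y z w)
    (ha : a 4 ≠ 0) (hI : I.OrdConnected) (hne : I.Nonempty) (hp : NowhereAEZero I p)
    (hmom : ∀ q : ℝ[X], Integrable fun x => I.indicator p x * q.eval x) (h3 : a 3 ≠ 0)
    (hdeg : (a 3).natDegree = (a 4).natDegree) : (frontier I).Nonempty := by
  have hdegree : (a 3).degree = (a 4).degree := by
    rw [degree_eq_natDegree h3, degree_eq_natDegree ha, hdeg]
  rcases nonneg_mul_div_atTop_or_atBot h3 hdegree with hN | hN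
  · exact ⟨_, csSup_mem_frontier hne
      (h.bddAbove_of_neg_le (N := 0) ha hI hp hmom (by simpa using hN))⟩
  · exact ⟨_, csInf_mem_frontier hne
      (h.bddBelow_of_neg_le (N := 0) ha hI hp hmom (by simpa using hN))⟩

theorem exists_ne_mem_frontier_of_natDegree_lt (h : DeterminingSystem a (I.indicator p) y z w)
    (ha : a 4 ≠ 0) (hI : I.OrdConnected) (hne : (interior I).Nonempty) (hp : NowhereAEZero I p)
    (hmom : ∀ q : ℝ[X], Integrable fun x => I.indicator p x * q.eval x)
    (hdeg : (a 3).natDegree < (a 4).natDegree) : ∃ l ∈ frontier I, ∃ r ∈ frontier I, l ≠ r := by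
  obtain ⟨N, hN⟩ := exists_nat_forall_neg_le_mul_div hdeg
  have habove := h.bddAbove_of_neg_le ha hI hp hmom
    (hN.filter_mono IsOrderBornology.atTop_le_cobounded)
  have hbelow := h.bddBelow_of_neg_le ha hI hp hmom
    (hN.filter_mono IsOrderBornology.atBot_le_cobounded)
  have hI₀ := hne.mono interior_subset
  refine ⟨_, csInf_mem_frontier hI₀ hbelow, _, csSup_mem_frontier hI₀ habove, fun heq => ?_⟩
  refine hne.ne_empty (subset_empty_iff.1 ?_)
  calc interior I ⊆ interior (Icc (sInf I) (sSup I)) :=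
        interior_mono (subset_Icc_csInf_csSup hbelow habove)
    _ = ∅ := by rw [interior_Icc, heq, Ioo_self]

theorem exists_two_frontier_roots (h : DeterminingSystem a (I.indicator p) y z w)
    (ha : a 4 ≠ 0) (hI : I.OrdConnected) (hne : (interior I).Nonempty) (hp : NowhereAEZero I p)
    (hmom : ∀ q : ℝ[X], Integrable fun x => I.indicator p x * q.eval x)
    (h1 : (a 1).natDegree ≤ 1) (h2 : (a 2).natDegree ≤ 2)
    (hroots : 1 < {r : ℝ | (a 4).IsRoot r}.encard) :
    ∃ l ∈ frontier I, ∃ r ∈ frontier I, l ≠ r := by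
  obtain ⟨s, t, hs, ht, hst⟩ := one_lt_encard_iff.1 hroots
  have hs_pos := (rootMultiplicity_pos ha).2 hs
  have ht_pos := (rootMultiplicity_pos ha).2 ht
  have hst_le := rootMultiplicity_add_le_natDegree (a 4) hst
  have hcompat := h.compatibility ha <| by
    simpa using hp.not_indicator_ae_eq_zero isOpen_univ (by rwa [univ_inter])
  obtain hlt | ⟨h3, h4⟩ := natDegree_three_lt_or_eq_two hcompat h1 h2 (by omega)
  · exact h.exists_ne_mem_frontier_of_natDegree_lt ha hI hne hp hmom hlt
  · exfalso
    obtain ⟨r, hr⟩ := h.frontier_nonempty_of_natDegree_eq ha hI (hne.mono interior_subset) hp hmom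
      (ne_zero_of_natDegree_gt (n := 0) (by omega)) (h3.trans h4.symm)
    have hr_two := h.rootMultiplicity_three_lt_of_mem_frontier ha hI.convex hne hp hr
    rcases eq_or_ne r s with rfl | hrs
    · omega
    · have := rootMultiplicity_add_le_natDegree (a 4) hrs
      omega

end DeterminingSystem

end Endpoints

theorem form_univ_indicator {I : Set ℝ} (hI : MeasurableSet I) (p u v : ℝ → ℝ) :
    form univ (I.indicator p) u v = form I p u v := by
  rw [form, form, Measure.restrict_univ, ← integral_indicator hI]
  simp only [indicator_mul_left]

theorem IsAdmissibleWeight.nowhereAEZero {I : Set ℝ} {p : ℝ → ℝ} (hp : IsAdmissibleWeight I p) :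
    NowhereAEZero I p := fun U hUI hU ⟨x, hx⟩ h0 => by
  obtain ⟨u, huU, hu_supp, hu, -, hux⟩ := exists_contDiff_tsupport_subset (n := ⊤) (hU.mem_nhds hx)
  refine (hp.posDef u (hu_supp.hasTemperateGrowth hu) ⟨x, hUI hx, by simp [hux]⟩).ne' ?_
  refine integral_eq_zero_of_ae (ae_restrict_of_ae ?_)
  filter_upwards [(ae_restrict_iff' hU.measurableSet).1 h0] with t ht
  by_cases htU : t ∈ U
  · simp [ht htU]
  · simp [image_eq_zero_of_notMem_tsupport fun h => htU (huU h)]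

end PolyDiffOp

open PolyDiffOp MeasureTheory Polynomial Set in
theorem corollary3p5_general {a : ℕ → ℝ[X]} {I : Set ℝ} {p : ℝ → ℝ} (ha : a 4 ≠ 0)
    (h1 : (a 1).natDegree ≤ 1) (h2 : (a 2).natDegree ≤ 2) (h4 : (a 4).natDegree ≤ 4)
    (hI : I.OrdConnected) (hne : (interior I).Nonempty) (hp : NowhereAEZero I p)
    (hint : ∀ q : ℝ[X], IntegrableOn (fun x => p x * q.eval x) I)
    (hsymm : ∀ u, IsTestFunction u → ∀ j : ℕ,
      form I p (apply 4 a u) (fun x => x ^ j) = form I p u (apply 4 a fun x => x ^ j))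
    (hroots : 1 < {r : ℝ | (a 4).IsRoot r}.encard) :
    {r : ℝ | (a 4).IsRoot r}.encard = 2 ∧
      ∀ r : ℝ, (a 4).IsRoot r →
        (a 4).rootMultiplicity r = 2 ∧ (a 3).rootMultiplicity r = 1 := by
  have hmom : ∀ q : ℝ[X], Integrable fun x => I.indicator p x * q.eval x := fun q =>
    ((hint q).integrable_indicator hI.measurableSet).congr
      (.of_forall fun _ => indicator_mul_left I p _)
  have hloc : LocallyIntegrable (I.indicator p) := by
    simpa only [eval_one, mul_one] using (hmom 1).locallyIntegrable
  obtain ⟨y, z, w, h⟩ := exists_determiningSystem hloc (a := a) <| by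
    simpa only [form_univ_indicator hI.measurableSet] using hsymm
  obtain ⟨l, hl, r, hr, hlr⟩ := h.exists_two_frontier_roots ha hI hne hp hmom h1 h2 hroots
  have hl_mult := h.rootMultiplicity_three_lt_of_mem_frontier ha hI.convex hne hp hl
  have hr_mult := h.rootMultiplicity_three_lt_of_mem_frontier ha hI.convex hne hp hr
  have hsum := rootMultiplicity_add_le_natDegree (a 4) hlr
  have hroot : ∀ s, (a 4).IsRoot s ↔ s = l ∨ s = r := fun s =>
    isRoot_iff_of_natDegree_le_rootMultiplicity_add ha hlr
      ((rootMultiplicity_pos ha).1 (by omega)) ((rootMultiplicity_pos ha).1 (by omega)) (by omega)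
  refine ⟨?_, fun s hs => ?_⟩
  · rw [show {s | (a 4).IsRoot s} = {l, r} from Set.ext hroot, encard_pair hlr]
  · rcases (hroot s).1 hs with rfl | rfl <;> omega

theorem corollary3p5 (a : ℕ → Polynomial ℝ)
    (hL : PolyDiffOp.IsSelfAdjointOfOrder 4 a)
    (hroots : 1 < {r : ℝ | (a 4).IsRoot r}.encard) :
    {r : ℝ | (a 4).IsRoot r}.encard = 2 ∧
      ∀ r : ℝ, (a 4).IsRoot r →
        (a 4).rootMultiplicity r = 2 ∧ (a 3).rootMultiplicity r = 1 := by
  obtain ⟨⟨ha, hdeg⟩, I, p, hI, hne, hp, hsymm⟩ := hL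
  exact corollary3p5_general ha (hdeg 1 (by decide)) (hdeg 2 (by decide))
    (hdeg 4 (by decide)) hI hne hp.nowhereAEZero hp.integrable
    (fun u hu j => hsymm u _ (hu.hasCompactSupport.hasTemperateGrowth hu.contDiff)
      (by fun_prop)) hroots
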